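/- Let $\Gamma$ be a countable discrete group acting continuously on a compact metrizable space $X$. Let $\mathcal M(X)$ be the space of Borel probability measures on $X$ with the weak$^*$-topology, a compact metrizable convex subset of $C(X)^*$, where $C(X)$ is the space of continuous functions $X\to\mathbb R$; $\Gamma$ acts continuously on $\mathcal M(X)$ by push-forward. We regard $X\subseteq\mathcal M(X)$ via $x\mapsto\delta_x$, and hence $X^k\subseteq\mathcal M(X)^k\subseteq (C(X)^*)^k$. For a continuous action of $\Gamma$ on a compact metrizable space $Y$, a $\Gamma$-invariant Borel probability measure $\nu$ on $Y$, and an integer $k\ge 1$, define $\mathrm{IN}^\nu_k(Y)\subseteq Y^k$ as follows. * For subsets $A_1,\dots,A_k$ of $Y$ and a family $D=(D_s)_{s\in\Gamma}$ of subsets of $Y$, a nonempty finite set $J\subseteq\Gamma$ is an independence set for $(A_1,\dots,A_k)$ relative to $D$ if $\bigcap_{s\in J}\bigl(D_s\cap s^{-1}A_{\sigma(s)}\bigr)\ne\emptyset$ for every map $\sigma:J\to\{1,\dots,k\}$. * The tuple $(A_1,\dots,A_k)$ has positive sequential $\nu$-independence density if there are $\delta,c>0$ such that for every $M>0$ there is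 a nonempty finite set $F\subseteq\Gamma$ with $|F|\ge M$ so that, for every family $D=(D_s)_{s\in\Gamma}$ of Borel subsets of $Y$ with $\nu(D_s)\ge 1-\delta$ for all $s\in\Gamma$, there is an independence set $J\subseteq F$ for $(A_1,\dots,A_k)$ relative to $D$ with $|J|\ge c|F|$. * $\mathrm{IN}^\nu_k(Y)$ is the set of all $(y_1,\dots,y_k)\in Y^k$ such that, whenever $U_j$ is a neighborhood of $y_j$ for $j=1,\dots,k$, the tuple $(U_1,\dots,U_k)$ has positive sequential $\nu$-independence density. **Theorem.** Let $m$ be a $\Gamma$-invariant Borel probability measure on $\mathcal M(X)$ and let $\mu\in\mathcal M(X)$ be its barycenter, i.e. $\phi(\mu)=\int_{\mathcal M(X)}\phi(\nu)\,dm(\nu)$ for every weak$^*$-continuous linear functional $\phi$ on $C(X)^*$ (the measure $\mu$ is then $\Gamma$-invariant). For every integer $k\ge 1$: 1. $\mathrm{IN}^m_k(\mathcal M(X))$ is contained in the closed convex hull of $\mathrm{IN}^\mu_k(X)$ in $\mathcal M(X)^k$. 2. $\mathrm{IN}^m_k(\mathcal M(X))\cap X^k\subseteq\mathrm{IN}^\mu_k(X)$.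 -/

import Mathlib

open MeasureTheory Set Filter Topology

noncomputable section

namespace MeasureIN

/-! ### The space of Borel probability measures -/

section ProbabilityMeasures

variable {X : Type*} [TopologicalSpace X] [MeasurableSpace X] [BorelSpace X]

/-- The weak* topology on `ProbabilityMeasure X` is generated by the conditions `∫ f dν ∈ U`. -/
theorem topology_eq_generateFrom :
    (inferInstance : TopologicalSpace (ProbabilityMeasure X)) =
      TopologicalSpace.generateFrom
        {A | ∃ (f : BoundedContinuousFunction X NNReal) (U : Set NNReal), IsOpen U ∧
          A = (fun ν : ProbabilityMeasure X => ν.toFiniteMeasure.testAgainstNN f) ⁻¹' U} := by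
  apply le_antisymm
  · apply le_generateFrom
    rintro A ⟨f, U, hU, rfl⟩
    exact hU.preimage (ProbabilityMeasure.continuous_testAgainstNN_eval f)
  · have h : @Continuous _ _ (TopologicalSpace.generateFrom
        {A | ∃ (f : BoundedContinuousFunction X NNReal) (U : Set NNReal), IsOpen U ∧
          A = (fun ν : ProbabilityMeasure X => ν.toFiniteMeasure.testAgainstNN f) ⁻¹' U}) _
        (fun ν : ProbabilityMeasure X => ν) := by
      refine @continuous_induced_rng _ _ _ _ _ _ (_) |>.2 ?_
      refine @continuous_induced_rng _ _ _ _ _ _ (_) |>.2 ?_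
      refine @WeakBilin.continuous_of_continuous_eval _ _ _ _ _ _ _ _ _ _ _ (_) _ fun f => ?_
      refine (@continuous_def _ _ (_) _ _).2 fun U hU => ?_
      exact TopologicalSpace.isOpen_generateFrom_of_mem ⟨f, U, hU, rfl⟩
    exact continuous_id_iff_le.1 h

variable [CompactSpace X]

/-- For compact metrizable `X`, the measurable structure which Mathlib puts on
`ProbabilityMeasure X` is the Borel σ-algebra of the weak* topology. -/
instance instBorelSpaceProbabilityMeasure [TopologicalSpace.MetrizableSpace X] :
    BorelSpace (ProbabilityMeasure X) := by
  let : MetricSpace X := TopologicalSpace.metrizableSpaceMetric X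
  have : SecondCountableTopology (ProbabilityMeasure X) := by
    let : MetricSpace (ProbabilityMeasure X) :=
      TopologicalSpace.metrizableSpaceMetric (ProbabilityMeasure X)
    infer_instance
  constructor
  apply le_antisymm
  · -- evaluation at a Borel set is Borel
    have key : @Measurable (ProbabilityMeasure X) (Measure X) (borel _) _
        (fun ν => (ν : Measure X)) := by
      let : MeasurableSpace (ProbabilityMeasure X) := borel _
      have : BorelSpace (ProbabilityMeasure X) := ⟨rfl⟩
      refine Measurable.measure_of_isPiSystem_of_isProbabilityMeasure
        (S := {s | IsOpen s}) (BorelSpace.measurable_eq) isPiSystem_isOpen ?_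
      intro U hU
      have hl : LowerSemicontinuous (fun ν : ProbabilityMeasure X => (ν : Measure X) U) := by
        intro ν
        refine lowerSemicontinuousAt_iff_le_liminf.2 ?_
        exact ProbabilityMeasure.le_liminf_measure_open_of_tendsto (L := 𝓝 ν) (μ := ν)
          (μs := id) tendsto_id hU
      exact hl.measurable
    exact Measurable.comap_le key
  · -- the weak* open sets are generated by countably many conditions on integrals
    rw [borel_eq_generateFrom_of_subbasis topology_eq_generateFrom]
    refine MeasurableSpace.generateFrom_le ?_
    rintro A ⟨f, U, hU, rfl⟩
    refine (?_ : Measurable (fun ν : ProbabilityMeasure X =>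
      ν.toFiniteMeasure.testAgainstNN f)) hU.measurableSet
    refine Measurable.ennreal_toNNReal ?_
    have hf : Measurable (fun x => (f x : ENNReal)) := f.continuous.measurable.coe_nnreal_ennreal
    exact (Measure.measurable_lintegral hf).comp measurable_subtype_coe

/-- A Borel probability measure on `X`, viewed as the functional `f ↦ ∫ f dν` in the dual of
`C(X, ℝ)`, which carries the weak* topology. -/
def toDual (ν : ProbabilityMeasure X) : WeakDual ℝ C(X, ℝ) :=
  StrongDual.toWeakDual <|
    LinearMap.mkContinuous
      { toFun := fun f => ∫ x, f x ∂(ν : Measure X)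
        map_add' := fun f g => integral_add
          (f.continuous.integrable_of_hasCompactSupport (HasCompactSupport.of_compactSpace _))
          (g.continuous.integrable_of_hasCompactSupport (HasCompactSupport.of_compactSpace _))
        map_smul' := fun c f => integral_const_mul c f }
      1
      (fun f => by
        have h := norm_integral_le_of_norm_le_const (μ := (ν : Measure X))
          (Eventually.of_forall fun x => f.norm_coe_le_norm x)
        simpa using h)

@[simp]
theorem toDual_apply (ν : ProbabilityMeasure X) (f : C(X, ℝ)) :
    toDual ν f = ∫ x, f x ∂(ν : Measure X) := rfl

/-- The inclusion of the `k`-fold power of the space of probability measures in the `k`-fold power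
of the weak* dual of `C(X, ℝ)`. -/
def tupleToDual {k : ℕ} (ν : Fin k → ProbabilityMeasure X) : Fin k → WeakDual ℝ C(X, ℝ) :=
  fun j => toDual (ν j)

/-- `x ↦ δ_x` in each coordinate. -/
def diracTuple {k : ℕ} (x : Fin k → X) : Fin k → ProbabilityMeasure X :=
  fun j => diracProba (x j)

/-- `μ` is the barycenter of the Borel probability measure `m` on the space of Borel probability
measures on `X`, a compact convex subset of the weak* dual of `C(X, ℝ)`: for every
(weak*-)continuous linear functional `φ`, the integral of `φ` with respect to `m` is `φ μ`. -/
def IsBarycenter (m : ProbabilityMeasure (ProbabilityMeasure X)) (μ : ProbabilityMeasure X) :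
    Prop :=
  ∀ φ : WeakDual ℝ C(X, ℝ) →L[ℝ] ℝ,
    ∫ ν, φ (toDual ν) ∂(m : Measure (ProbabilityMeasure X)) = φ (toDual μ)

end ProbabilityMeasures

/-! ### The induced action on probability measures -/

/-- The induced action of `Γ` on probability measures by push-forward. -/
instance instMulActionProbabilityMeasure {Γ X : Type*} [Group Γ] [MeasurableSpace X]
    [MulAction Γ X] [MeasurableConstSMul Γ X] : MulAction Γ (ProbabilityMeasure X) where
  smul s ν := ν.map (f := fun x => s • x) (measurable_const_smul s).aemeasurable
  one_smul ν := by
    apply Subtype.ext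
    change Measure.map (fun x : X => (1 : Γ) • x) (ν : Measure X) = ν
    simp
  mul_smul s t ν := by
    apply Subtype.ext
    change Measure.map (fun x : X => (s * t) • x) (ν : Measure X) =
      Measure.map (fun x : X => s • x) (Measure.map (fun x : X => t • x) (ν : Measure X))
    rw [Measure.map_map (measurable_const_smul s) (measurable_const_smul t)]
    congr 1
    funext x
    exact mul_smul s t x

theorem coe_smul {Γ X : Type*} [Group Γ] [MeasurableSpace X] [MulAction Γ X]
    [MeasurableConstSMul Γ X] (s : Γ) (ν : ProbabilityMeasure X) :
    ((s • ν : ProbabilityMeasure X) : Measure X) =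
      Measure.map (fun x => s • x) (ν : Measure X) := rfl

/-! ### Measure IN-tuples -/

section INTuples

variable (Γ : Type*) {Y : Type*} [SMul Γ Y] {k : ℕ}

variable {Γ} in
/-- The nonempty finite set `F ⊆ Γ` is an independence set for the tuple `A = (A₁, …, A_k)`
relative to `D : Γ → 2^Y`: for every `σ : F → [k]`, the intersection of the sets
`D_s ∩ s⁻¹ A_{σ(s)}` over `s ∈ F` is nonempty. -/
def IsIndepSetRel (A : Fin k → Set Y) (D : Γ → Set Y) (F : Finset Γ) : Prop :=
  F.Nonempty ∧ ∀ σ : F → Fin k,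
    (⋂ s : F, D (s : Γ) ∩ (fun y : Y => (s : Γ) • y) ⁻¹' A (σ s)).Nonempty

/-- The families `D` of Borel sets indexed by `Γ` with `μ (D s) ≥ 1 - δ` for all `s`. -/
def largeFamilies [MeasurableSpace Y] (μ : ProbabilityMeasure Y) (δ : ℝ) : Set (Γ → Set Y) :=
  {D | (∀ s, MeasurableSet (D s)) ∧ ∀ s, 1 - δ ≤ (μ : Measure Y).real (D s)}

/-- The tuple `A` has positive sequential `μ`-independence density. -/
def HasPosSeqIndepDensity [MeasurableSpace Y] (μ : ProbabilityMeasure Y) (A : Fin k → Set Y) :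
    Prop :=
  ∃ δ : ℝ, 0 < δ ∧ ∃ c : ℝ, 0 < c ∧ ∀ M : ℝ, 0 < M →
    ∃ F : Finset Γ, F.Nonempty ∧ M ≤ (F.card : ℝ) ∧
      ∀ D ∈ largeFamilies Γ μ δ, ∃ J : Finset Γ, J ⊆ F ∧ IsIndepSetRel A D J ∧
        c * (F.card : ℝ) ≤ (J.card : ℝ)

variable (k) in
/-- The set of `μ`-IN-tuples of length `k`. -/
def measureIN [TopologicalSpace Y] [MeasurableSpace Y] (μ : ProbabilityMeasure Y) :
    Set (Fin k → Y) :=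
  {y | ∀ U : Fin k → Set Y, (∀ j, U j ∈ 𝓝 (y j)) → HasPosSeqIndepDensity Γ μ U}

end INTuples

end MeasureIN

end

/-!
By the Hahn–Banach theorem, both claims follow from one inequality: if `ν` is an IN-tuple of `m` and
`∑ j, ∫ f j dν j > u` for continuous functions `f j` on `X`, then `∑ j, f j (y j) ≥ u` for some
IN-tuple `y` of `μ`. For the second claim `f j` is the negative of the distance to the `j`-th point.

Let `J` be an independence set for neighborhoods of the `ν j` on which the integrals of the `f j`
remain large, relative to the sets of measures almost concentrated on `D s`; these sets are large
for `m` by Markov's inequality. For each `σ : J → Fin k` this gives a measure, and by averaging a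
point `x`, such that `x` lies in most of the `D s` and `f (σ s)` is on average large at `s • x`.
Recording the member of a fine finite cover of `X` in which `s • x` has been found turns each `σ`
into a word of length `|J|`, with a score for each letter. It remains to find one letter for each
`j`, with large total score, such that all combinations of these letters occur on a subset of `J` of
positive proportion.

To this end, weight the letters by the exponential of a small multiple of their score, so that the
`k ^ |J|` words have total weight at least `k ^ |J|`. By induction on the length, as in the
Sauer–Shelah lemma, the weight of a set of words is at most `θ ^ |J|` times a power of the number of
patterns it shatters, for some `θ < k`. Hence exponentially many patterns are shattered, and one of
them prescribes a positive proportion of the coordinates.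
-/

namespace MeasureIN

section Patterns

open Matrix

variable {ι L β : Type*} {n : ℕ}

/-- A pattern `P : Fin n → Option β` prescribes at some coordinates `s` the index of one of the
transversals `p b : ι → L`. A set `S` of words of length `n` shatters `P` if for every `τ` it
contains a word whose letter is `p b (τ s)` at each coordinate `s` with `P s = some b`. -/
def Shatters (p : β → ι → L) (S : Finset (Fin n → L)) (P : Fin n → Option β) : Prop :=
  ∀ τ : Fin n → ι, ∃ u ∈ S, ∀ s, ∀ b ∈ P s, u s = p b (τ s)

open scoped Classical in
/-- The patterns shattered by `S`. Their number is the potential which controls the weight of `S`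
in `exists_weight_le_pow_mul_card_shattered_pow`. -/
noncomputable def shattered [Fintype β] (p : β → ι → L) (S : Finset (Fin n → L)) :
    Finset (Fin n → Option β) :=
  {P | Shatters p S P}

@[simp]
theorem mem_shattered [Fintype β] {p : β → ι → L} {S : Finset (Fin n → L)}
    {P : Fin n → Option β} : P ∈ shattered p S ↔ Shatters p S P := by
  simp [shattered]

theorem shattered_mono [Fintype β] (p : β → ι → L) {S T : Finset (Fin n → L)} (h : S ⊆ T) :
    shattered p S ⊆ shattered p T := fun P hP => by
  rw [mem_shattered] at hP ⊢
  exact fun τ => (hP τ).imp fun _ hu => ⟨h hu.1, hu.2⟩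

variable [DecidableEq L]

/-- The words obtained by removing the first letter from those words in `S` whose first letter
lies in `Q`. -/
def tails (S : Finset (Fin (n + 1) → L)) (Q : Finset L) : Finset (Fin n → L) :=
  {u ∈ S | u 0 ∈ Q}.image vecTail

theorem mem_tails {S : Finset (Fin (n + 1) → L)} {Q : Finset L} {v : Fin n → L} :
    v ∈ tails S Q ↔ ∃ a ∈ Q, vecCons a v ∈ S := by
  simp only [tails, Finset.mem_image, Finset.mem_filter]
  constructor
  · rintro ⟨u, ⟨hu, hQ⟩, rfl⟩
    exact ⟨u 0, hQ, by rwa [show vecCons (u 0) (vecTail u) = u from cons_head_tail u]⟩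
  · rintro ⟨a, ha, hS⟩
    exact ⟨_, ⟨hS, by simpa⟩, by simp⟩

theorem tails_mono (S : Finset (Fin (n + 1) → L)) {Q Q' : Finset L} (h : Q ⊆ Q') :
    tails S Q ⊆ tails S Q' :=
  Finset.image_subset_image (Finset.monotone_filter_right S fun _ _ hu => h hu)

section Growth

variable [Fintype L] {p : β → ι → L} {S : Finset (Fin (n + 1) → L)} {P : Fin n → Option β}

theorem Shatters.cons_none (h : Shatters p (tails S Finset.univ) P) :
    Shatters p S (vecCons none P) := fun τ => by
  obtain ⟨v, hv, hvP⟩ := h (vecTail τ)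
  obtain ⟨a, -, hS⟩ := mem_tails.1 hv
  exact ⟨_, hS, Fin.cases (by simp) fun s => by simpa [vecTail] using hvP s⟩

omit [Fintype L] in
theorem Shatters.cons_some {b : β} (h : ∀ j, Shatters p (tails S {p b j}) P) :
    Shatters p S (vecCons (some b) P) := fun τ => by
  obtain ⟨v, hv, hvP⟩ := h (τ 0) (vecTail τ)
  obtain ⟨a, ha, hS⟩ := mem_tails.1 hv
  obtain rfl := Finset.mem_singleton.1 ha
  exact ⟨_, hS, Fin.cases (by simp) fun s => by simpa [vecTail] using hvP s⟩

variable [Fintype β]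

theorem card_shattered_tails_le :
    (shattered p (tails S Finset.univ)).card ≤ (shattered p S).card :=
  Finset.card_le_card_of_injOn (vecCons none)
    (fun _ hP => Finset.mem_coe.2 <| mem_shattered.2 (mem_shattered.1 hP).cons_none)
    fun _ _ _ _ h => (vecCons_inj.1 h).2

/-- A shattered pattern for the tails extends by `none`, and also by `some b` if it is shattered
after every letter of the transversal `p b`. -/
theorem card_shattered_add_le (b : β) (𝒬 : Finset (Fin n → Option β))
    (h𝒬 : ∀ P ∈ 𝒬, ∀ j, P ∈ shattered p (tails S {p b j})) :
    (shattered p (tails S Finset.univ)).card + 𝒬.card ≤ (shattered p S).card := by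
  classical
  have hinj (o : Option β) : Function.Injective (vecCons o : (Fin n → Option β) → _) :=
    fun _ _ h => (vecCons_inj.1 h).2
  rw [← Finset.card_image_of_injective _ (hinj none),
    ← Finset.card_image_of_injective 𝒬 (hinj (some b)), ← Finset.card_union_of_disjoint]
  · refine Finset.card_le_card (Finset.union_subset ?_ ?_) <;>
      refine Finset.image_subset_iff.2 fun P hP => mem_shattered.2 ?_
    · exact (mem_shattered.1 hP).cons_none
    · exact Shatters.cons_some fun j => mem_shattered.1 (h𝒬 P hP j)
  · simp only [Finset.disjoint_left, Finset.mem_image]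
    rintro _ ⟨P, -, rfl⟩ ⟨P', -, h⟩
    simpa using (vecCons_inj.1 h).1

end Growth

theorem card_sub_sum_le_card_filter_forall_mem {α κ : Type*} [DecidableEq α] [Fintype κ]
    (s : Finset α) (t : κ → Finset α) (ht : ∀ j, t j ⊆ s) :
    (s.card : ℝ) - ∑ j, ((s.card : ℝ) - (t j).card) ≤ ({a ∈ s | ∀ j, a ∈ t j}.card : ℝ) := by
  have hcover : s \ {a ∈ s | ∀ j, a ∈ t j} ⊆ Finset.univ.biUnion fun j => s \ t j := by
    intro a ha
    simp_all
  have hcard := (Finset.card_le_card hcover).trans Finset.card_biUnion_le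
  have hcard' : ((s \ {a ∈ s | ∀ j, a ∈ t j}).card : ℝ) ≤ ∑ j, ((s \ t j).card : ℝ) := by
    exact_mod_cast hcard
  simp only [Finset.cast_card_sdiff (Finset.filter_subset _ _),
    Finset.cast_card_sdiff (ht _)] at hcard'
  linarith

theorem three_halves_mul_card_shattered_tails_le [Fintype ι] [Fintype L] [Fintype β] {p : β → ι → L}
    {S : Finset (Fin (n + 1) → L)} {ζ : ℝ} (hζ : Fintype.card ι * ζ ≤ 1 / 2) (b : β)
    (hb : ∀ j, (1 - ζ) * (shattered p (tails S Finset.univ)).card ≤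
      (shattered p (tails S {p b j})).card) :
    3 / 2 * ((shattered p (tails S Finset.univ)).card : ℝ) ≤ (shattered p S).card := by
  classical
  set 𝒯 := shattered p (tails S Finset.univ)
  have hsub (j : ι) : shattered p (tails S {p b j}) ⊆ 𝒯 :=
    shattered_mono p (tails_mono S (Finset.subset_univ _))
  have hinter := card_sub_sum_le_card_filter_forall_mem 𝒯 _ hsub
  have hgrow : (𝒯.card : ℝ) + {P ∈ 𝒯 | ∀ j, P ∈ shattered p (tails S {p b j})}.card ≤
      (shattered p S).card := by
    exact_mod_cast card_shattered_add_le (p := p) b _ fun P hP => (Finset.mem_filter.1 hP).2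
  have hloss : ∑ j, ((𝒯.card : ℝ) - (shattered p (tails S {p b j})).card) ≤ 1 / 2 * 𝒯.card :=
    calc ∑ j, ((𝒯.card : ℝ) - (shattered p (tails S {p b j})).card)
        ≤ ∑ _j : ι, ζ * 𝒯.card := Finset.sum_le_sum fun j _ => by linarith [hb j]
      _ = Fintype.card ι * ζ * 𝒯.card := by simp [mul_assoc]
      _ ≤ 1 / 2 * 𝒯.card := by gcongr
  linarith

/-- The total weight of the words in `S`, the weight of a word being the product of the weights
of its letters. -/
def weight (w : L → ℝ) (S : Finset (Fin n → L)) : ℝ :=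
  ∑ u ∈ S, ∏ s, w (u s)

section Weight

variable {w : L → ℝ} {π : L → ι} {S : Finset (Fin (n + 1) → L)}

omit [DecidableEq L] in
theorem eq_of_comp_vecTail_eq {Q : Finset L} {j : ι} (hQ : ∀ a ∈ Q, π a = j)
    (hS : Set.InjOn (π ∘ ·) (S : Set (Fin (n + 1) → L))) {u u' : Fin (n + 1) → L}
    (hu : u ∈ S) (hu' : u' ∈ S) (huQ : u 0 ∈ Q) (huQ' : u' 0 ∈ Q)
    (h : π ∘ vecTail u = π ∘ vecTail u') : u = u' :=
  hS hu hu' <| funext <| Fin.cases ((hQ _ huQ).trans (hQ _ huQ').symm) fun s => congrFun h s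

theorem injOn_tails {Q : Finset L} {j : ι} (hQ : ∀ a ∈ Q, π a = j)
    (hS : Set.InjOn (π ∘ ·) (S : Set (Fin (n + 1) → L))) :
    Set.InjOn (π ∘ ·) (tails S Q : Set (Fin n → L)) := by
  simp only [tails, Finset.coe_image, Finset.coe_filter]
  rintro _ ⟨u, hu, rfl⟩ _ ⟨u', hu', rfl⟩ h
  rw [eq_of_comp_vecTail_eq hQ hS hu.1 hu'.1 hu.2 hu'.2 h]

theorem weight_filter_le (hw : 0 ≤ w) {Q : Finset L} {j : ι} (hQ : ∀ a ∈ Q, π a = j)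
    (hS : Set.InjOn (π ∘ ·) (S : Set (Fin (n + 1) → L))) {M : ℝ} (hM : ∀ a ∈ Q, w a ≤ M) :
    weight w {u ∈ S | u 0 ∈ Q} ≤ M * weight w (tails S Q) := by
  have hinj : Set.InjOn vecTail ({u ∈ S | u 0 ∈ Q} : Set (Fin (n + 1) → L)) :=
    fun u hu u' hu' h => eq_of_comp_vecTail_eq hQ hS hu.1 hu'.1 hu.2 hu'.2 (congrArg (π ∘ ·) h)
  rw [weight, weight, tails, Finset.sum_image (by simpa using hinj), Finset.mul_sum]
  refine Finset.sum_le_sum fun u hu => ?_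
  rw [Fin.prod_univ_succ]
  exact mul_le_mul_of_nonneg_right (hM _ (Finset.mem_filter.1 hu).2)
    (Finset.prod_nonneg fun _ _ => hw _)

/-- The words starting in `B` are grouped according to the class of their first letter, the others
according to the first letter itself. -/
theorem weight_le_sum_add_sum [Fintype ι] [DecidableEq ι] [Fintype L] (hw : 0 ≤ w)
    (hS : Set.InjOn (π ∘ ·) (S : Set (Fin (n + 1) → L))) (B : Finset L) {M : ι → ℝ}
    (hM : ∀ a ∈ B, w a ≤ M (π a)) :
    weight w S ≤ ∑ j, M j * weight w (tails S {a ∈ B | π a = j}) +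
      ∑ a ∈ Bᶜ, w a * weight w (tails S {a}) := by
  have hsplit : weight w S = ∑ j, weight w {u ∈ S | u 0 ∈ ({a ∈ B | π a = j} : Finset L)} +
      ∑ a ∈ Bᶜ, weight w {u ∈ S | u 0 ∈ ({a} : Finset L)} := by
    simp only [weight, Finset.mem_filter, Finset.mem_singleton]
    rw [← Finset.sum_filter_add_sum_filter_not S (fun u => u 0 ∈ B)]
    congr 1
    · rw [← Finset.sum_fiberwise {u ∈ S | u 0 ∈ B} fun u => π (u 0)]
      simp only [Finset.filter_filter]
    · rw [← Finset.sum_fiberwise_of_maps_to (t := Bᶜ) (g := fun u => u 0) (by simp)]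
      refine Finset.sum_congr rfl fun a ha => Finset.sum_congr ?_ fun _ _ => rfl
      ext u
      rw [Finset.mem_compl] at ha
      simp only [Finset.mem_filter]
      grind
  rw [hsplit]
  gcongr with j _ a _
  · exact weight_filter_le hw (fun a ha => (Finset.mem_filter.1 ha).2) hS fun a ha => by
      obtain ⟨haB, rfl⟩ := Finset.mem_filter.1 ha
      exact hM a haB
  · refine weight_filter_le (π := π) hw (j := π a) ?_ hS ?_ <;> simp

theorem weight_le_mul_add_mul [Fintype ι] [DecidableEq ι] [Fintype L] (hw : 0 ≤ w)
    (hS : Set.InjOn (π ∘ ·) (S : Set (Fin (n + 1) → L))) {B : Finset L} {M : ι → ℝ}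
    (hM₀ : 0 ≤ M) (hM : ∀ a ∈ B, w a ≤ M (π a)) {W W' : ℝ} (hW'₀ : 0 ≤ W')
    (hW : ∀ j, weight w (tails S {a ∈ B | π a = j}) ≤ W)
    (hW' : ∀ a ∉ B, weight w (tails S {a}) ≤ W') :
    weight w S ≤ (∑ j, M j) * W + (∑ a, w a) * W' := by
  refine (weight_le_sum_add_sum hw hS B hM).trans ?_
  rw [Finset.sum_mul, Finset.sum_mul]
  refine add_le_add (Finset.sum_le_sum fun j _ => mul_le_mul_of_nonneg_left (hW j) (hM₀ j)) ?_
  exact (Finset.sum_le_sum fun a ha => mul_le_mul_of_nonneg_left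
    (hW' a (Finset.mem_compl.1 ha)) (hw a)).trans <|
    Finset.sum_le_sum_of_subset_of_nonneg (Finset.subset_univ _)
      fun a _ _ => mul_nonneg (hw a) hW'₀

omit [DecidableEq L] in
theorem weight_le_card_shattered_pow [Fintype β] (p : β → ι → L) (S : Finset (Fin 0 → L))
    (C : ℕ) : weight w S ≤ ((shattered p S).card : ℝ) ^ C := by
  obtain rfl | ⟨u, hu⟩ := S.eq_empty_or_nonempty
  · simp [weight]
  have hS : S.card ≤ 1 := Finset.card_le_one_of_subsingleton S
  have hshattered : 1 ≤ (shattered p S).card :=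
    Finset.card_pos.2 ⟨default, mem_shattered.2 fun _ => ⟨u, hu, fun s => s.elim0⟩⟩
  calc weight w S = S.card := by simp [weight]
    _ ≤ 1 := by exact_mod_cast hS
    _ ≤ ((shattered p S).card : ℝ) ^ C := one_le_pow₀ (by exact_mod_cast hshattered)

section Step

variable [Fintype ι] [Fintype L] [Fintype β] {p : β → ι → L} {θ θ' ζ : ℝ} {C : ℕ}

theorem weight_le_mul_card_shattered_tails_pow (hw : 0 ≤ w) (hθ' : 0 ≤ θ')
    (hS : Set.InjOn (π ∘ ·) (S : Set (Fin (n + 1) → L)))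
    (ih : ∀ T : Finset (Fin n → L), Set.InjOn (π ∘ ·) (T : Set (Fin n → L)) →
      weight w T ≤ θ' ^ n * ((shattered p T).card : ℝ) ^ C)
    {B : Finset L} {M : ι → ℝ} (hM₀ : 0 ≤ M) (hM : ∀ a ∈ B, w a ≤ M (π a)) {r : ℝ} (hr : 0 ≤ r)
    (hB : ∀ a ∉ B, ((shattered p (tails S {a})).card : ℝ) ≤
      r * (shattered p (tails S Finset.univ)).card) :
    weight w S ≤ (∑ j, M j + (∑ a, w a) * r ^ C) *
      (θ' ^ n * ((shattered p (tails S Finset.univ)).card : ℝ) ^ C) := by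
  classical
  have hclass (j : ι) : weight w (tails S {a ∈ B | π a = j}) ≤
      θ' ^ n * ((shattered p (tails S Finset.univ)).card : ℝ) ^ C := by
    refine (ih _ (injOn_tails (j := j) (by simp) hS)).trans ?_
    gcongr
    exact shattered_mono p (tails_mono S (Finset.subset_univ _))
  have hletter (a : L) (ha : a ∉ B) : weight w (tails S {a}) ≤
      θ' ^ n * (r * (shattered p (tails S Finset.univ)).card) ^ C := by
    refine (ih _ (injOn_tails (j := π a) (by simp) hS)).trans ?_
    gcongr
    exact hB a ha
  refine (weight_le_mul_add_mul hw hS hM₀ hM (by positivity) hclass hletter).trans_eq ?_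
  rw [mul_pow]
  ring

omit [DecidableEq L] in
/-- Either some transversal consists of letters after which almost all patterns remain shattered,
and then the number of patterns grows; or the letters with this property are light. -/
theorem weight_le_pow_succ_mul (hw : 0 ≤ w) (hθ' : 0 ≤ θ')
    (hζ : Fintype.card ι * ζ ≤ 1 / 2) (hζ' : ζ ≤ 1 / 3) (hθ : 0 ≤ θ)
    (hC : (∑ a, w a) * (1 - ζ) ^ C ≤ θ' - θ)
    (hlight : ∀ B : Finset L, (∀ b, ∃ j, p b j ∉ B) →
      ∃ M : ι → ℝ, 0 ≤ M ∧ (∀ a ∈ B, w a ≤ M (π a)) ∧ ∑ j, M j ≤ θ)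
    (hS : Set.InjOn (π ∘ ·) (S : Set (Fin (n + 1) → L)))
    (ih : ∀ T : Finset (Fin n → L), Set.InjOn (π ∘ ·) (T : Set (Fin n → L)) →
      weight w T ≤ θ' ^ n * ((shattered p T).card : ℝ) ^ C) :
    weight w S ≤ θ' ^ (n + 1) * ((shattered p S).card : ℝ) ^ C := by
  classical
  have hw₀ : 0 ≤ ∑ a, w a := Finset.sum_nonneg fun a _ => hw a
  have hζ₀ : 0 ≤ 1 - ζ := by linarith
  set y := ((shattered p (tails S Finset.univ)).card : ℝ)
  set N := ((shattered p S).card : ℝ)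
  set B : Finset L := {a | (1 - ζ) * y < (shattered p (tails S {a})).card} with hBdef
  by_cases htrans : ∃ b, ∀ j, p b j ∈ B
  · obtain ⟨b, hb⟩ := htrans
    have hgrow : 3 / 2 * y ≤ N :=
      three_halves_mul_card_shattered_tails_le hζ b fun j => (Finset.mem_filter.1 (hb j)).2.le
    have hy : y ≤ (1 - ζ) * N := by
      nlinarith [(shattered p S).card.cast_nonneg (α := ℝ)]
    calc weight w S ≤ (∑ _j : ι, 0 + (∑ a, w a) * 1 ^ C) * (θ' ^ n * y ^ C) :=
          weight_le_mul_card_shattered_tails_pow (B := ∅) (M := 0) hw hθ' hS ih le_rfl (by simp)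
            zero_le_one fun a _ => by
              rw [one_mul]
              exact_mod_cast Finset.card_le_card
                (shattered_mono p (tails_mono S (Finset.subset_univ _)))
      _ = (∑ a, w a) * (θ' ^ n * y ^ C) := by simp
      _ ≤ (∑ a, w a) * (θ' ^ n * ((1 - ζ) * N) ^ C) := by gcongr
      _ = (∑ a, w a) * (1 - ζ) ^ C * (θ' ^ n * N ^ C) := by rw [mul_pow]; ring
      _ ≤ θ' * (θ' ^ n * N ^ C) := by gcongr; linarith
      _ = θ' ^ (n + 1) * N ^ C := by rw [pow_succ]; ring
  · push Not at htrans
    obtain ⟨M, hM₀, hM, hMsum⟩ := hlight B htrans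
    calc weight w S ≤ (∑ j, M j + (∑ a, w a) * (1 - ζ) ^ C) * (θ' ^ n * y ^ C) :=
          weight_le_mul_card_shattered_tails_pow hw hθ' hS ih hM₀ hM hζ₀ fun a ha => by
            simpa [hBdef] using ha
      _ ≤ θ' * (θ' ^ n * N ^ C) := by
          gcongr
          · linarith
          · exact Nat.cast_le.2 card_shattered_tails_le
      _ = θ' ^ (n + 1) * N ^ C := by rw [pow_succ]; ring

end Step

omit [DecidableEq L] in
theorem exists_weight_le_pow_mul_card_shattered_pow [Fintype ι] [Finite L] [Fintype β]
    {p : β → ι → L} {w : L → ℝ} {π : L → ι} {θ θ' : ℝ} (hw : 0 ≤ w) (hθ : 0 ≤ θ) (hθθ' : θ < θ')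
    (hlight : ∀ B : Finset L, (∀ b, ∃ j, p b j ∉ B) →
      ∃ M : ι → ℝ, 0 ≤ M ∧ (∀ a ∈ B, w a ≤ M (π a)) ∧ ∑ j, M j ≤ θ) :
    ∃ C : ℕ, ∀ (n : ℕ) (S : Finset (Fin n → L)), Set.InjOn (π ∘ ·) (S : Set (Fin n → L)) →
      weight w S ≤ θ' ^ n * ((shattered p S).card : ℝ) ^ C := by
  have := Fintype.ofFinite L
  set ζ : ℝ := 1 / (2 * Fintype.card ι + 3) with hζdef
  have hζ : 0 < ζ := by positivity
  have hζι : Fintype.card ι * ζ ≤ 1 / 2 := by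
    rw [hζdef, mul_one_div, div_le_div_iff₀ (by positivity) (by positivity)]
    linarith
  have hζ' : ζ ≤ 1 / 3 := one_div_le_one_div_of_le (by norm_num) (by simp)
  obtain ⟨C, hC⟩ : ∃ C : ℕ, (∑ a, w a) * (1 - ζ) ^ C ≤ θ' - θ := by
    have hlim : Tendsto (fun C : ℕ => (∑ a, w a) * (1 - ζ) ^ C) atTop (𝓝 0) := by
      simpa using (tendsto_pow_atTop_nhds_zero_of_lt_one (by linarith) (by linarith)).const_mul
        (∑ a, w a)
    exact (hlim.eventually_le_const (sub_pos.2 hθθ')).exists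
  refine ⟨C, fun n => ?_⟩
  induction n with
  | zero => exact fun S _ => by simpa using weight_le_card_shattered_pow p S C
  | succ n ih =>
    exact fun S hS =>
      weight_le_pow_succ_mul hw (hθ.trans hθθ'.le) hζι hζ' hθ hC hlight hS ih

end Weight

end Patterns

section IndependentSections

open scoped Finset

theorem exists_card_le_pow_of_mul_card_ne_none_le {β : Type*} [Finite β] {ρ : ℝ} (hρ : 1 < ρ) :
    ∃ q : ℕ, 0 < q ∧ ∀ (n : ℕ) (T : Finset (Fin n → Option β)),
      (∀ P ∈ T, q * #{s | P s ≠ none} ≤ n) → (T.card : ℝ) ≤ ρ ^ n := by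
  have := Fintype.ofFinite β
  obtain ⟨y, hρy, hy₁⟩ := exists_between (inv_lt_one_of_one_lt₀ hρ)
  have hρ₀ : 0 < ρ := one_pos.trans hρ
  have hy₀ : 0 < y := (inv_pos.2 hρ₀).trans hρy
  obtain ⟨q, hq, hq₀⟩ : ∃ q : ℕ, 1 + Fintype.card β * y ^ q ≤ ρ * y ∧ 0 < q := by
    have hlim : Tendsto (fun q : ℕ => 1 + Fintype.card β * y ^ q) atTop (𝓝 1) := by
      simpa using ((tendsto_pow_atTop_nhds_zero_of_lt_one hy₀.le hy₁).const_mul _).const_add (1 : ℝ)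
    have hlt : 1 < ρ * y := (inv_lt_iff_one_lt_mul₀' hρ₀).1 hρy
    exact ((hlim.eventually_le_const hlt).and (eventually_gt_atTop 0)).exists
  refine ⟨q, hq₀, fun n T hT => ?_⟩
  let v (o : Option β) : ℝ := if o = none then 1 else y ^ q
  have hv (o : Option β) : 0 ≤ v o := by dsimp only [v]; split_ifs <;> positivity
  have hprod (P : Fin n → Option β) (hP : P ∈ T) : y ^ n ≤ ∏ s, v (P s) := by
    rw [Finset.prod_ite, Finset.prod_const_one, one_mul, Finset.prod_const, ← pow_mul]
    exact pow_le_pow_of_le_one hy₀.le hy₁.le (hT P hP)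
  have hcount : (T.card : ℝ) * y ^ n ≤ ρ ^ n * y ^ n :=
    calc (T.card : ℝ) * y ^ n = ∑ _P ∈ T, y ^ n := by simp
      _ ≤ ∑ P ∈ T, ∏ s, v (P s) := Finset.sum_le_sum hprod
      _ ≤ ∑ P : Fin n → Option β, ∏ s, v (P s) :=
          Finset.sum_le_sum_of_subset_of_nonneg (Finset.subset_univ _)
            fun P _ _ => Finset.prod_nonneg fun s _ => hv _
      _ = (1 + Fintype.card β * y ^ q) ^ n := by
          rw [← Fintype.piFinset_univ, Finset.sum_prod_piFinset Finset.univ fun _ => v]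
          simp [v, Fintype.sum_option]
      _ ≤ (ρ * y) ^ n := by gcongr
      _ = ρ ^ n * y ^ n := mul_pow _ _ _
  exact le_of_mul_le_mul_right hcount (by positivity)

theorem exists_sum_le_of_forall_section {ι L : Type*} [Fintype ι] [Nonempty ι] (π : L → ι)
    (f : L → ℝ) (B : Finset L) {r : ℝ}
    (hB : ∀ p : ι → L, (∀ j, π (p j) = j) → (∀ j, p j ∈ B) → ∑ j, f (p j) ≤ r) :
    ∃ h : ι → ℝ, (∀ a ∈ B, f a ≤ h (π a)) ∧ ∑ j, h j ≤ r := by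
  classical
  by_cases hfib : ∀ j, {a ∈ B | π a = j}.Nonempty
  · choose p hp hmax using fun j => Finset.exists_max_image _ f (hfib j)
    simp only [Finset.mem_filter] at hp hmax
    exact ⟨fun j => f (p j), fun a ha => hmax _ a ⟨ha, rfl⟩,
      hB p (fun j => (hp j).2) fun j => (hp j).1⟩
  · push Not at hfib
    obtain ⟨j₀, hj₀⟩ := hfib
    set G := ∑ a ∈ B, |f a|
    refine ⟨fun j => G - if j = j₀ then Fintype.card ι * G - r else 0, fun a ha => ?_, ?_⟩
    · have hne : π a ≠ j₀ := fun h => Finset.notMem_empty a (hj₀ ▸ by simp [ha, h])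
      simpa [hne] using (le_abs_self _).trans
        (Finset.single_le_sum (f := fun a => |f a|) (fun _ _ => abs_nonneg _) ha)
    · simp

theorem eventually_sum_exp_mul_lt_card {ι : Type*} [Fintype ι] {h : ι → ℝ} (hh : ∑ j, h j < 0) :
    ∀ᶠ t in 𝓝[>] (0 : ℝ), ∑ j, Real.exp (t * h j) < Fintype.card ι := by
  have hderiv : HasDerivAt (fun t => ∑ j, Real.exp (t * h j)) (∑ j, h j) 0 :=
    HasDerivAt.fun_sum fun j _ => by
      simpa using ((hasDerivAt_id (0 : ℝ)).mul_const (h j)).exp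
  have hslope := (hasDerivAt_iff_tendsto_slope.1 hderiv).mono_left
    (nhdsWithin_mono _ fun t (ht : 0 < t) => ht.ne')
  filter_upwards [hslope.eventually_lt_const hh, self_mem_nhdsWithin] with t ht ht₀
  rw [slope_def_field, div_neg_iff] at ht
  have ht₀ : 0 < t := ht₀
  simpa [ht₀.not_gt, ht₀] using ht

theorem exists_sum_exp_mul_le {κ ι : Type*} [Finite κ] [Fintype ι] [Nonempty ι] {h : κ → ι → ℝ}
    (hh : ∀ b, ∑ j, h b j < 0) :
    ∃ t > 0, ∃ θ : ℝ, 0 ≤ θ ∧ θ < Fintype.card ι ∧ ∀ b, ∑ j, Real.exp (t * h b j) ≤ θ := by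
  obtain ⟨t, ht, ht₀⟩ := ((eventually_all.2 fun b => eventually_sum_exp_mul_lt_card (hh b)).and
    self_mem_nhdsWithin).exists
  have hcard : (0 : ℝ) < Fintype.card ι := by exact_mod_cast Fintype.card_pos
  obtain ⟨θ, hθ, hθ₀⟩ := ((eventually_all.2 fun b => Ico_mem_nhdsLT (ht b)).and
    (Ico_mem_nhdsLT hcard)).exists
  exact ⟨t, ht₀, θ, hθ₀.1, hθ₀.2, fun b => (hθ b).1⟩

variable {ι L β : Type*} [Fintype ι] [Finite β] {p : β → ι → L} {w : L → ℝ} {π : L → ι}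

theorem exists_shatters_lt_mul_card_ne_none [Finite L] {θ : ℝ} (hw : 0 ≤ w) (hθ : 0 ≤ θ)
    (hθι : θ < Fintype.card ι)
    (hlight : ∀ B : Finset L, (∀ b, ∃ j, p b j ∉ B) →
      ∃ M : ι → ℝ, 0 ≤ M ∧ (∀ a ∈ B, w a ≤ M (π a)) ∧ ∑ j, M j ≤ θ) :
    ∃ q : ℕ, 0 < q ∧ ∀ n > 0, ∀ S : Finset (Fin n → L),
      Set.InjOn (π ∘ ·) (S : Set (Fin n → L)) → (Fintype.card ι : ℝ) ^ n ≤ weight w S →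
      ∃ P, Shatters p S P ∧ n < q * #{s | P s ≠ none} := by
  classical
  have := Fintype.ofFinite β
  obtain ⟨θ', hθθ', hθ'ι⟩ := exists_between hθι
  obtain ⟨C, hC⟩ := exists_weight_le_pow_mul_card_shattered_pow hw hθ hθθ' hlight
  obtain ⟨ρ, hρι, hρ⟩ : ∃ ρ : ℝ, θ' * ρ ^ C < Fintype.card ι ∧ 1 < ρ := by
    have hcont : Tendsto (fun ρ : ℝ => θ' * ρ ^ C) (𝓝[>] 1) (𝓝 θ') := by
      have : ContinuousAt (fun ρ : ℝ => θ' * ρ ^ C) 1 := by fun_prop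
      simpa [ContinuousAt] using this.mono_left nhdsWithin_le_nhds
    exact ((hcont.eventually_lt_const hθ'ι).and self_mem_nhdsWithin).exists
  obtain ⟨q, hq, hcount⟩ := exists_card_le_pow_of_mul_card_ne_none_le (β := β) hρ
  refine ⟨q, hq, fun n hn S hS hweight => ?_⟩
  by_contra! hsmall
  have hθ'₀ : 0 ≤ θ' := hθ.trans hθθ'.le
  refine (pow_lt_pow_left₀ hρι (by positivity) hn.ne').not_ge ?_
  calc (Fintype.card ι : ℝ) ^ n ≤ θ' ^ n * ((shattered p S).card : ℝ) ^ C :=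
        hweight.trans (hC n S hS)
    _ ≤ θ' ^ n * (ρ ^ n) ^ C := by
        gcongr
        exact hcount n _ fun P hP => hsmall P (mem_shattered.1 hP)
    _ = (θ' * ρ ^ C) ^ n := by rw [mul_pow, ← pow_mul, ← pow_mul, mul_comm n]

theorem exists_transversal_of_card_pow_le_weight [Finite L] {θ : ℝ} (hw : 0 ≤ w) (hθ : 0 ≤ θ)
    (hθι : θ < Fintype.card ι)
    (hlight : ∀ B : Finset L, (∀ b, ∃ j, p b j ∉ B) →
      ∃ M : ι → ℝ, 0 ≤ M ∧ (∀ a ∈ B, w a ≤ M (π a)) ∧ ∑ j, M j ≤ θ) :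
    ∃ c : ℝ, 0 < c ∧ ∀ n > 0, ∀ S : Finset (Fin n → L),
      Set.InjOn (π ∘ ·) (S : Set (Fin n → L)) → (Fintype.card ι : ℝ) ^ n ≤ weight w S →
      ∃ b, ∃ W : Finset (Fin n), c * n ≤ W.card ∧
        ∀ τ : Fin n → ι, ∃ u ∈ S, ∀ s ∈ W, u s = p b (τ s) := by
  classical
  have := Fintype.ofFinite β
  obtain ⟨q, hq, hP⟩ := exists_shatters_lt_mul_card_ne_none hw hθ hθι hlight
  refine ⟨1 / (q * (Fintype.card β + 1)), by positivity, fun n hn S hS hweight => ?_⟩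
  obtain ⟨P, hShatters, hPcard⟩ := hP n hn S hS hweight
  set V : Finset (Fin n) := {s | P s ≠ none}
  have hVcard : (n : ℝ) ≤ q * #V := by exact_mod_cast hPcard.le
  obtain ⟨s₀, hs₀⟩ : V.Nonempty :=
    Finset.card_pos.1 (Nat.pos_of_mul_pos_left (n.zero_le.trans_lt hPcard))
  have hmaps (s : Fin n) (hs : s ∈ V) : P s ∈ ({none}ᶜ : Finset (Option β)) := by
    simpa [V] using hs
  obtain ⟨o, ho, hcard⟩ := Finset.exists_le_card_fiber_of_nsmul_le_card_of_maps_to hmaps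
    ⟨_, hmaps s₀ hs₀⟩ (b := 1 / (q * (Fintype.card β + 1)) * (n : ℝ)) (by
      have : (0 : ℝ) < q := by exact_mod_cast hq
      rw [Finset.card_compl, Finset.card_singleton, Fintype.card_option, Nat.add_sub_cancel,
        nsmul_eq_mul]
      field_simp
      nlinarith)
  obtain ⟨b, rfl⟩ := Option.ne_none_iff_exists'.1 (by simpa using ho)
  refine ⟨b, {s ∈ V | P s = some b}, hcard, fun τ => ?_⟩
  obtain ⟨u, hu, huP⟩ := hShatters τ
  exact ⟨u, hu, fun s hs => huP s b (Finset.mem_filter.1 hs).2⟩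

theorem exists_exp_le_sum_le_of_forall_section [Finite L] [Nonempty ι] (π : L → ι) (f : L → ℝ)
    {ε : ℝ} (hε : 0 < ε) :
    ∃ t > 0, ∃ θ : ℝ, 0 ≤ θ ∧ θ < Fintype.card ι ∧ ∀ B : Finset L,
      (∀ p : ι → L, (∀ j, π (p j) = j) → -ε ≤ ∑ j, f (p j) → ∃ j, p j ∉ B) →
      ∃ M : ι → ℝ, 0 ≤ M ∧ (∀ a ∈ B, Real.exp (t * f a) ≤ M (π a)) ∧ ∑ j, M j ≤ θ := by
  have hbound (B : {B : Finset L // ∀ p : ι → L, (∀ j, π (p j) = j) → -ε ≤ ∑ j, f (p j) →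
      ∃ j, p j ∉ B}) : ∃ h : ι → ℝ, (∀ a ∈ B.1, f a ≤ h (π a)) ∧ ∑ j, h j ≤ -ε :=
    exists_sum_le_of_forall_section π f B fun p hp hpB => by
      by_contra! hlt
      obtain ⟨j, hj⟩ := B.2 p hp hlt.le
      exact hj (hpB j)
  choose h hfh hsum using hbound
  obtain ⟨t, ht, θ, hθ, hθι, hexp⟩ :=
    exists_sum_exp_mul_le fun B => (hsum B).trans_lt (neg_lt_zero.2 hε)
  exact ⟨t, ht, θ, hθ, hθι, fun B hB => ⟨fun j => Real.exp (t * h ⟨B, hB⟩ j),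
    fun j => (Real.exp_pos _).le, fun a ha => Real.exp_le_exp.2 <|
      mul_le_mul_of_nonneg_left (hfh ⟨B, hB⟩ a ha) ht.le, hexp ⟨B, hB⟩⟩⟩

/-- Words are weighted by the exponential of a multiple of their score, so that a set of letters
containing no section of score at least `-ε` is light. -/
theorem exists_independent_section [Finite L] (π : L → ι) (f : L → ℝ) {ε : ℝ} (hε : 0 < ε) :
    ∃ c : ℝ, 0 < c ∧ ∀ n > 0, ∀ ω : (Fin n → ι) → Fin n → L, (∀ σ s, π (ω σ s) = σ s) →
      (∀ σ, 0 ≤ ∑ s, f (ω σ s)) →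
      ∃ p : ι → L, (∀ j, π (p j) = j) ∧ -ε ≤ ∑ j, f (p j) ∧
        ∃ W : Finset (Fin n), c * n ≤ #W ∧
          ∀ τ : Fin n → ι, ∃ σ, ∀ s ∈ W, ω σ s = p (τ s) := by
  classical
  cases isEmpty_or_nonempty ι
  · exact ⟨1, one_pos, fun n _ ω _ _ => ⟨isEmptyElim, isEmptyElim, by simp [hε.le], Finset.univ,
      by simp, fun τ => ⟨τ, fun s => isEmptyElim (τ s)⟩⟩⟩
  obtain ⟨t, ht, θ, hθ, hθι, hlight⟩ := exists_exp_le_sum_le_of_forall_section π f hε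
  let Section := {p : ι → L // (∀ j, π (p j) = j) ∧ -ε ≤ ∑ j, f (p j)}
  obtain ⟨c, hc, htransversal⟩ := exists_transversal_of_card_pow_le_weight
    (p := fun p : Section => p.1) (fun a => (Real.exp_pos (t * f a)).le) hθ hθι
    fun B hB => hlight B fun p hp hpε => hB ⟨p, hp, hpε⟩
  refine ⟨c, hc, fun n hn ω hπ hf => ?_⟩
  have hπ' (σ : Fin n → ι) : π ∘ ω σ = σ := funext (hπ σ)
  have hinj : Function.Injective ω := Function.LeftInverse.injective hπ'
  have hinjOn : Set.InjOn (π ∘ ·) (Finset.univ.image ω : Set (Fin n → L)) := by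
    rw [Finset.coe_image, Finset.coe_univ, image_univ]
    rintro _ ⟨σ, rfl⟩ _ ⟨σ', rfl⟩ h
    exact congrArg ω (by simpa only [hπ'] using h)
  obtain ⟨⟨p, hp, hpε⟩, W, hW, hτ⟩ := htransversal n hn (Finset.univ.image ω) hinjOn
    (calc (Fintype.card ι : ℝ) ^ n = ∑ _σ : Fin n → ι, 1 := by simp
      _ ≤ ∑ σ, Real.exp (t * ∑ s, f (ω σ s)) := Finset.sum_le_sum fun σ _ =>
          Real.one_le_exp (mul_nonneg ht.le (hf σ))
      _ = weight _ (Finset.univ.image ω) := by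
          simp only [weight, Finset.sum_image hinj.injOn, Finset.mul_sum, Real.exp_sum])
  refine ⟨p, hp, hpε, W, hW, fun τ => ?_⟩
  obtain ⟨_, hu, huW⟩ := hτ τ
  obtain ⟨σ, -, rfl⟩ := Finset.mem_image.1 hu
  exact ⟨σ, huW⟩

theorem exists_independent_selection {Γ O : Type*} [Finite O] (g : ι → O → ℝ) {ε : ℝ}
    (hε : 0 < ε) :
    ∃ c : ℝ, 0 < c ∧ ∀ J : Finset Γ, J.Nonempty → ∀ o : (J → ι) → J → O,
      (∀ σ, 0 ≤ ∑ s, g (σ s) (o σ s)) →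
      ∃ q : ι → O, -ε ≤ ∑ j, g j (q j) ∧
        ∃ W ⊆ J, c * #J ≤ #W ∧ ∀ τ : J → ι, ∃ σ, ∀ s : J, s.1 ∈ W → o σ s = q (τ s) := by
  obtain ⟨c, hc, hsection⟩ :=
    exists_independent_section (Prod.fst : ι × O → ι) (fun a => g a.1 a.2) hε
  refine ⟨c, hc, fun J hJ o ho => ?_⟩
  let e := J.equivFin
  obtain ⟨p, hp, hpε, W, hW, hτ⟩ := hsection #J hJ.card_pos
    (fun σ s => (σ s, o (σ ∘ e) (e.symm s))) (fun σ s => rfl) fun σ => by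
      simpa using (ho (σ ∘ e)).trans_eq (e.symm.sum_comp _).symm
  refine ⟨fun j => (p j).2, by simpa only [hp] using hpε,
    (W.map e.symm.toEmbedding).map (Function.Embedding.subtype _), ?_, by simpa using hW,
    fun τ => ?_⟩
  · simp +contextual [Finset.subset_iff]
  · obtain ⟨σ, hσ⟩ := hτ (τ ∘ e.symm)
    refine ⟨σ ∘ e, fun s hs => ?_⟩
    have hsW : e s ∈ W := by simpa [Equiv.symm_apply_eq] using hs
    simpa using congrArg Prod.snd (hσ (e s) hsW)

end IndependentSections

section Barycenter

theorem measurable_coe_measure {Y : Type*} [MeasurableSpace Y] :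
    Measurable fun ν : ProbabilityMeasure Y => (ν : Measure Y) :=
  measurable_subtype_coe

theorem measurable_measureReal {Y : Type*} [MeasurableSpace Y] {D : Set Y}
    (hD : MeasurableSet D) :
    Measurable fun ν : ProbabilityMeasure Y => (ν : Measure Y).real D :=
  ((Measure.measurable_coe hD).comp measurable_coe_measure).ennreal_toReal

variable {X : Type*} [TopologicalSpace X] [MeasurableSpace X] [BorelSpace X] [CompactSpace X]

theorem integrable_continuousMap (ν : ProbabilityMeasure X) (f : C(X, ℝ)) :
    Integrable f (ν : Measure X) :=
  f.continuous.integrable_of_hasCompactSupport (HasCompactSupport.of_compactSpace _)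

theorem continuous_integral (f : C(X, ℝ)) :
    Continuous fun ν : ProbabilityMeasure X => ∫ x, f x ∂(ν : Measure X) :=
  continuous_iff_continuousAt.2 fun _ =>
    ProbabilityMeasure.tendsto_iff_forall_integral_tendsto.1 tendsto_id
      (BoundedContinuousFunction.mkOfCompact f)

variable {m : ProbabilityMeasure (ProbabilityMeasure X)} {μ : ProbabilityMeasure X}

theorem IsBarycenter.integral_integral (h : IsBarycenter m μ) (f : C(X, ℝ)) :
    ∫ ν, ∫ x, f x ∂(ν : Measure X) ∂(m : Measure (ProbabilityMeasure X)) =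
      ∫ x, f x ∂(μ : Measure X) :=
  h (WeakBilin.eval (topDualPairing ℝ C(X, ℝ)) f)

variable [TopologicalSpace.MetrizableSpace X]

theorem IsBarycenter.eq_bind (h : IsBarycenter m μ) :
    (μ : Measure X) = (m : Measure (ProbabilityMeasure X)).bind fun ν => (ν : Measure X) := by
  let : MetricSpace X := TopologicalSpace.metrizableSpaceMetric X
  refine ext_of_forall_lintegral_eq_of_IsFiniteMeasure fun f => ?_
  let f' : C(X, ℝ) := ⟨fun x => f x, by fun_prop⟩
  have hf (ν : ProbabilityMeasure X) :
      ∫⁻ x, f x ∂(ν : Measure X) = ENNReal.ofReal (∫ x, f' x ∂(ν : Measure X)) := by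
    rw [ofReal_integral_eq_lintegral_ofReal (integrable_continuousMap ν f')
      (Eventually.of_forall fun x => NNReal.coe_nonneg _)]
    simp [f']
  rw [Measure.lintegral_bind measurable_coe_measure.aemeasurable
    f.continuous.measurable.coe_nnreal_ennreal.aemeasurable]
  simp only [hf]
  rw [← h.integral_integral, ofReal_integral_eq_lintegral_ofReal]
  · exact integrable_continuousMap m ⟨_, continuous_integral f'⟩
  · exact Eventually.of_forall fun ν => integral_nonneg fun x => NNReal.coe_nonneg _

theorem IsBarycenter.integral_measureReal (h : IsBarycenter m μ) {D : Set X}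
    (hD : MeasurableSet D) :
    ∫ ν, (ν : Measure X).real D ∂(m : Measure (ProbabilityMeasure X)) = (μ : Measure X).real D := by
  rw [measureReal_def, h.eq_bind, Measure.bind_apply hD measurable_coe_measure.aemeasurable]
  exact integral_toReal ((Measure.measurable_coe hD).comp measurable_coe_measure).aemeasurable
    (Eventually.of_forall fun ν => measure_lt_top (ν : Measure X) D)

theorem one_sub_le_measureReal_le_of_integral_le {Ω : Type*} [MeasurableSpace Ω] {P : Measure Ω}
    [IsProbabilityMeasure P] {f : Ω → ℝ} (hf : 0 ≤ f) (hmeas : Measurable f) (hi : Integrable f P)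
    {δ η : ℝ} (hη : 0 < η) (hfδ : ∫ ω, f ω ∂P ≤ δ * η) : 1 - δ ≤ P.real {ω | f ω ≤ η} := by
  have hmarkov : η * P.real {ω | η ≤ f ω} ≤ η * δ :=
    (mul_meas_ge_le_integral_of_nonneg (Eventually.of_forall hf) hi η).trans
      (hfδ.trans_eq (mul_comm _ _))
  have hsub : {ω | f ω ≤ η}ᶜ ⊆ {ω | η ≤ f ω} := fun ω (hω : ¬f ω ≤ η) => (not_le.1 hω).le
  have hcompl : P.real {ω | f ω ≤ η}ᶜ ≤ δ :=
    (measureReal_mono hsub).trans (le_of_mul_le_mul_left hmarkov hη)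
  rw [probReal_compl_eq_one_sub (measurableSet_le hmeas measurable_const)] at hcompl
  linarith

theorem IsBarycenter.sublevel_mem_largeFamilies {Γ : Type*} (h : IsBarycenter m μ) {δ η : ℝ}
    (hη : 0 < η) {D : Γ → Set X} (hD : D ∈ largeFamilies Γ μ (δ * η)) :
    (fun s => {ν : ProbabilityMeasure X | (ν : Measure X).real (D s)ᶜ ≤ η}) ∈
      largeFamilies Γ m δ := by
  have hmeas (s : Γ) := measurable_measureReal (hD.1 s).compl
  refine ⟨fun s => measurableSet_le (hmeas s) measurable_const, fun s =>
    one_sub_le_measureReal_le_of_integral_le (fun _ => measureReal_nonneg) (hmeas s) ?_ hη ?_⟩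
  · refine Integrable.of_bound (hmeas s).aestronglyMeasurable 1 (Eventually.of_forall fun ν => ?_)
    rw [Real.norm_of_nonneg measureReal_nonneg]
    exact measureReal_le_one
  · rw [h.integral_measureReal (hD.1 s).compl, probReal_compl_eq_one_sub (hD.1 s)]
    linarith [hD.2 s]

/-- The first moment method. -/
theorem exists_sum_le_sum_sub_indicator {Ω α : Type*} [MeasurableSpace Ω] [Fintype α]
    (P : Measure Ω) [IsProbabilityMeasure P] {h : α → Ω → ℝ} (hi : ∀ s, Integrable (h s) P)
    {D : α → Set Ω} (hD : ∀ s, MeasurableSet (D s)) {η L : ℝ} (hL : 0 ≤ L)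
    (hη : ∀ s, P.real (D s) ≤ η) :
    ∃ ω, ∑ s, (∫ ω, h s ω ∂P - L * η) ≤ ∑ s, (h s ω - L * (D s).indicator 1 ω) := by
  have hind (s : α) : Integrable (fun ω => L * (D s).indicator (1 : Ω → ℝ) ω) P :=
    ((integrable_const (1 : ℝ)).indicator (hD s)).const_mul L
  obtain ⟨ω, hω⟩ := exists_integral_le (integrable_finsetSum Finset.univ fun s _ =>
    (hi s).sub (hind s))
  refine ⟨ω, le_trans ?_ hω⟩
  rw [integral_finsetSum _ fun s _ => (hi s).sub (hind s)]
  refine Finset.sum_le_sum fun s _ => ?_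
  rw [integral_sub' (hi s) (hind s), integral_const_mul, integral_indicator_one (hD s)]
  gcongr
  exact hη s

end Barycenter

section Density

variable {Γ Y β : Type*} [MeasurableSpace Y] {μ : ProbabilityMeasure Y}

theorem iInter_mem_largeFamilies [Fintype β] {D : β → Γ → Set Y} {δ δ' : ℝ}
    (hD : ∀ b, D b ∈ largeFamilies Γ μ δ) (hδ : Fintype.card β * δ ≤ δ') :
    (fun s => ⋂ b, D b s) ∈ largeFamilies Γ μ δ' := by
  have hmeas (s : Γ) : MeasurableSet (⋂ b, D b s) := .iInter fun b => (hD b).1 s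
  refine ⟨hmeas, fun s => ?_⟩
  have hcompl : (μ : Measure Y).real (⋂ b, D b s)ᶜ ≤ δ' :=
    calc (μ : Measure Y).real (⋂ b, D b s)ᶜ ≤ ∑ b, (μ : Measure Y).real (D b s)ᶜ := by
          rw [compl_iInter]
          exact measureReal_iUnion_fintype_le _
      _ ≤ ∑ _b : β, δ := Finset.sum_le_sum fun b _ => by
          rw [probReal_compl_eq_one_sub ((hD b).1 s)]
          linarith [(hD b).2 s]
      _ ≤ δ' := by simpa using hδ
  rw [probReal_compl_eq_one_sub (hmeas s)] at hcompl
  linarith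

variable [SMul Γ Y] {k : ℕ}

omit [MeasurableSpace Y] in
theorem IsIndepSetRel.mono {A A' : Fin k → Set Y} {D D' : Γ → Set Y} {J : Finset Γ}
    (h : IsIndepSetRel A D J) (hA : ∀ j, A j ⊆ A' j) (hD : ∀ s, D s ⊆ D' s) :
    IsIndepSetRel A' D' J :=
  ⟨h.1, fun σ => (h.2 σ).mono <| iInter_mono fun s =>
    inter_subset_inter (hD s) (preimage_mono (hA _))⟩

theorem HasPosSeqIndepDensity.mono {A A' : Fin k → Set Y} (h : HasPosSeqIndepDensity Γ μ A)
    (hA : ∀ j, A j ⊆ A' j) : HasPosSeqIndepDensity Γ μ A' := by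
  obtain ⟨δ, hδ, c, hc, hF⟩ := h
  refine ⟨δ, hδ, c, hc, fun M hM => ?_⟩
  obtain ⟨F, hFne, hFM, hFD⟩ := hF M hM
  refine ⟨F, hFne, hFM, fun D hD => ?_⟩
  obtain ⟨J, hJF, hJ, hcard⟩ := hFD D hD
  exact ⟨J, hJF, hJ.mono hA fun _ => subset_rfl, hcard⟩

variable (Γ μ) in
/-- The weakening of positive sequential `μ`-independence density in which the tuple, among the
`A b`, of which `J` is an independence set may depend on the family `D`. -/
def HasSharedIndepDensity (A : β → Fin k → Set Y) : Prop :=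
  ∃ δ : ℝ, 0 < δ ∧ ∃ c : ℝ, 0 < c ∧ ∀ M : ℝ, 0 < M →
    ∃ F : Finset Γ, F.Nonempty ∧ M ≤ (F.card : ℝ) ∧
      ∀ D ∈ largeFamilies Γ μ δ, ∃ b, ∃ J : Finset Γ, J ⊆ F ∧ IsIndepSetRel (A b) D J ∧
        c * (F.card : ℝ) ≤ (J.card : ℝ)

/-- If each tuple fails for some family of sets, then all fail for the intersection. -/
theorem HasSharedIndepDensity.exists_hasPosSeqIndepDensity [Finite β] {A : β → Fin k → Set Y}
    (h : HasSharedIndepDensity Γ μ A) : ∃ b, HasPosSeqIndepDensity Γ μ (A b) := by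
  obtain ⟨δ, hδ, c, hc, hF⟩ := h
  have := Fintype.ofFinite β
  set δ' : ℝ := δ / (Fintype.card β + 1) with hδ'
  by_contra! hfail
  have hfail' (b : β) : ∃ M : ℝ, 0 < M ∧ ∀ F : Finset Γ, F.Nonempty → M ≤ (F.card : ℝ) →
      ∃ D ∈ largeFamilies Γ μ δ', ∀ J : Finset Γ, J ⊆ F → IsIndepSetRel (A b) D J →
        (J.card : ℝ) < c * F.card := by
    by_contra! hb
    exact hfail b ⟨δ', by positivity, c, hc, hb⟩
  choose M hM hMF using hfail'
  have hMsum : 0 ≤ ∑ b, M b := Finset.sum_nonneg fun b _ => (hM b).le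
  obtain ⟨F, hFne, hFM, hFD⟩ := hF (∑ b, M b + 1) (by positivity)
  have hMF' (b : β) : M b ≤ F.card := by
    linarith [Finset.single_le_sum (fun b _ => (hM b).le) (Finset.mem_univ b)]
  choose D hD hDJ using fun b => hMF b F hFne (hMF' b)
  have hδδ' : Fintype.card β * δ' ≤ δ := by
    rw [hδ', mul_div_assoc', div_le_iff₀ (by positivity)]
    linarith
  obtain ⟨b, J, hJF, hJ, hcard⟩ := hFD _ (iInter_mem_largeFamilies hD hδδ')
  exact (hDJ b J hJF (hJ.mono (fun _ => subset_rfl) fun s => iInter_subset _ b)).not_ge hcard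

end Density

section Transfer

theorem exists_penalty_for_none {ι β : Type*} [Fintype ι] [Finite β] (a : ι → β → ℝ) (ε : ℝ) :
    ∃ g : ι → Option β → ℝ, ∃ L : ℝ, 0 < L ∧ (∀ j b, g j (some b) = a j b) ∧
      (∀ j b, a j b - L ≤ g j none) ∧
      ∀ q : ι → Option β, -ε ≤ ∑ j, g j (q j) → ∀ j, q j ≠ none := by
  classical
  obtain ⟨C, hC⟩ := (finite_range fun p : ι × β => a p.1 p.2).bddAbove
  replace hC (j : ι) (b : β) : a j b ≤ |C| := (hC ⟨(j, b), rfl⟩).trans (le_abs_self C)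
  set K : ℝ := Fintype.card ι * |C| + |ε| + 1
  have hgC (j : ι) (o : Option β) : o.elim (-K) (a j) ≤ |C| := by
    cases o with
    | none => exact (neg_nonpos.2 (by positivity)).trans (abs_nonneg C)
    | some b => exact hC j b
  refine ⟨fun j o => o.elim (-K) (a j), K + |C|, by positivity, fun _ _ => rfl, fun j b => ?_,
    fun q hq i hi => hq.not_gt ?_⟩
  · linarith [hC j b, show Option.elim none (-K) (a j) = -K from rfl]
  · have hothers : ∑ j ∈ Finset.univ.erase i, (q j).elim (-K) (a j) ≤ Fintype.card ι * |C| := by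
      refine (Finset.sum_le_card_nsmul _ _ _ fun j _ => hgC j (q j)).trans ?_
      rw [nsmul_eq_mul]
      gcongr
      exact Finset.card_le_univ _
    rw [← Finset.add_sum_erase _ _ (Finset.mem_univ i), hi]
    linarith [le_abs_self ε, show Option.elim none (-K) (a i) = -K from rfl]

/-- A value `o s = some b` records that `x ∈ D s` and that `s • x` has been seen in `U b`. -/
theorem exists_isIndepSetRel_of_sum_nonneg {Γ Y β : Type*} [SMul Γ Y] [Finite β] {k : ℕ}
    (U : β → Set Y) {g : Fin k → Option β → ℝ} {ε : ℝ} (hε : 0 < ε)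
    (hg : ∀ q : Fin k → Option β, -ε ≤ ∑ j, g j (q j) → ∀ j, q j ≠ none) :
    ∃ c : ℝ, 0 < c ∧ ∀ J : Finset Γ, J.Nonempty → ∀ D : Γ → Set Y,
      (∀ σ : J → Fin k, ∃ x, ∃ o : J → Option β,
        (∀ s, ∀ b ∈ o s, x ∈ D s ∧ (s : Γ) • x ∈ U b) ∧ 0 ≤ ∑ s, g (σ s) (o s)) →
      ∃ q : Fin k → β, -ε ≤ ∑ j, g j (some (q j)) ∧
        ∃ J' ⊆ J, IsIndepSetRel (fun j => U (q j)) D J' ∧ c * (J.card : ℝ) ≤ J'.card := by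
  classical
  obtain ⟨c, hc, hsel⟩ := exists_independent_selection (Γ := Γ) g hε
  refine ⟨c, hc, fun J hJ D hx => ?_⟩
  choose x o ho hsum using hx
  obtain ⟨q, hq, W, hWJ, hcard, hW⟩ := hsel J hJ o hsum
  choose p hp using fun j => Option.ne_none_iff_exists'.1 (hg q hq j)
  obtain rfl : q = fun j => some (p j) := funext hp
  obtain ⟨s₀, hs₀⟩ : W.Nonempty := by
    rw [← Finset.card_pos, ← Nat.cast_pos (α := ℝ)]
    exact lt_of_lt_of_le (mul_pos hc (Nat.cast_pos.2 hJ.card_pos)) hcard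
  refine ⟨p, hq, W, hWJ, ⟨⟨s₀, hs₀⟩, fun τ => ?_⟩, hcard⟩
  obtain ⟨σ, hσ⟩ := hW fun s => if h : s.1 ∈ W then τ ⟨s, h⟩ else τ ⟨s₀, hs₀⟩
  refine ⟨x σ, mem_iInter.2 fun s => ?_⟩
  have hos := hσ ⟨s, hWJ s.2⟩ s.2
  rw [dif_pos s.2] at hos
  exact ho σ _ _ hos

variable {Γ X β : Type*} [Group Γ] [TopologicalSpace X] [CompactSpace X]
  [MeasurableSpace X] [BorelSpace X] [MulAction Γ X]
  [ContinuousConstSMul Γ X] {k : ℕ}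

theorem exists_visits_sum_nonneg {ν : ProbabilityMeasure X} {J : Finset Γ} {σ : J → Fin k}
    {f : Fin k → C(X, ℝ)} {v : Fin k → ℝ}
    (hν : ∀ s : J, v (σ s) ≤ ∫ x, f (σ s) x ∂((s : Γ) • ν : ProbabilityMeasure X))
    {D : Γ → Set X} (hD : ∀ s, MeasurableSet (D s)) {η : ℝ}
    (hνD : ∀ s : J, (ν : Measure X).real (D s)ᶜ ≤ η) {U : β → Set X} (hU : ∀ x, ∃ b, x ∈ U b)
    {g : Fin k → Option β → ℝ} {ε L : ℝ} (hL : 0 ≤ L) (hLη : L * η ≤ ε)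
    (hsome : ∀ j b, ∀ x ∈ U b, f j x - v j + ε ≤ g j (some b))
    (hnone : ∀ j x, f j x - v j + ε - L ≤ g j none) :
    ∃ x, ∃ o : J → Option β, (∀ s, ∀ b ∈ o s, x ∈ D s ∧ (s : Γ) • x ∈ U b) ∧
      0 ≤ ∑ s, g (σ s) (o s) := by
  classical
  have hint (s : J) : Integrable (fun x => f (σ s) ((s : Γ) • x)) (ν : Measure X) :=
    integrable_continuousMap ν ⟨_, (f (σ s)).continuous.comp (continuous_const_smul _)⟩
  have hmap (s : J) : v (σ s) ≤ ∫ x, f (σ s) ((s : Γ) • x) ∂(ν : Measure X) := by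
    refine (hν s).trans_eq ?_
    rw [coe_smul]
    exact integral_map (measurable_const_smul _).aemeasurable
      (f (σ s)).continuous.aestronglyMeasurable
  obtain ⟨x, hx⟩ := exists_sum_le_sum_sub_indicator (ν : Measure X) hint
    (fun s : J => (hD s).compl) hL hνD
  choose b hb using hU
  refine ⟨x, fun s => if x ∈ D s then some (b ((s : Γ) • x)) else none, fun s b' hb' => ?_, ?_⟩
  · obtain ⟨hxD, rfl⟩ : x ∈ D s ∧ b ((s : Γ) • x) = b' := by simpa using hb'
    exact ⟨hxD, hb _⟩
  · have hscore (s : J) : ∫ x, f (σ s) ((s : Γ) • x) ∂(ν : Measure X) - L * η -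
        (f (σ s) ((s : Γ) • x) - L * (D s)ᶜ.indicator 1 x) ≥
        - g (σ s) (if x ∈ D s then some (b ((s : Γ) • x)) else none) := by
      by_cases hxD : x ∈ D s
      · simp only [hxD, if_true, mem_compl_iff, not_true_eq_false, not_false_eq_true,
          indicator_of_notMem]
        linarith [hsome (σ s) _ _ (hb ((s : Γ) • x)), hmap s]
      · simp only [hxD, if_false, mem_compl_iff, not_false_eq_true, indicator_of_mem,
          Pi.one_apply]
        linarith [hnone (σ s) ((s : Γ) • x), hmap s]
    have := Finset.sum_le_sum fun s (_ : s ∈ Finset.univ) => hscore s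
    rw [Finset.sum_neg_distrib, Finset.sum_sub_distrib] at this
    linarith

variable [TopologicalSpace.MetrizableSpace X] {m : ProbabilityMeasure (ProbabilityMeasure X)}
  {μ : ProbabilityMeasure X}

theorem IsBarycenter.hasSharedIndepDensity [Finite β] (hμ : IsBarycenter m μ)
    {f : Fin k → C(X, ℝ)} {v : Fin k → ℝ}
    (hv : HasPosSeqIndepDensity Γ m fun j =>
      {ν : ProbabilityMeasure X | v j ≤ ∫ x, f j x ∂(ν : Measure X)})
    {U : β → Set X} (hU : ∀ x, ∃ b, x ∈ U b) {a : Fin k → β → ℝ}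
    (ha : ∀ j b, ∀ x ∈ U b, f j x ≤ a j b) {u : ℝ} (hu : u < ∑ j, v j) :
    HasSharedIndepDensity Γ μ
      fun (q : {q : Fin k → β // u ≤ ∑ j, a j (q j)}) j => U (q.1 j) := by
  set ε : ℝ := (∑ j, v j - u) / (k + 1) with hε_def
  have hε : 0 < ε := div_pos (sub_pos.2 hu) (by positivity)
  have hεu : (k + 1) * ε = ∑ j, v j - u := by
    rw [hε_def]
    field_simp
  obtain ⟨g, L, hL, hgsome, hgnone, hg⟩ := exists_penalty_for_none (fun j b => a j b - v j + ε) ε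
  obtain ⟨δ, hδ, c₁, hc₁, hF⟩ := hv
  obtain ⟨c₂, hc₂, hindep⟩ := exists_isIndepSetRel_of_sum_nonneg (Γ := Γ) U hε hg
  have hη : 0 < ε / L := div_pos hε hL
  refine ⟨δ * (ε / L), by positivity, c₂ * c₁, by positivity, fun M hM => ?_⟩
  obtain ⟨F, hFne, hFM, hFD⟩ := hF M hM
  refine ⟨F, hFne, hFM, fun D hD => ?_⟩
  obtain ⟨J, hJF, ⟨hJne, hJ⟩, hJcard⟩ := hFD _ (hμ.sublevel_mem_largeFamilies hη hD)
  obtain ⟨q, hq, J', hJ'J, hJ', hJ'card⟩ := hindep J hJne D fun σ => by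
    obtain ⟨ν, hν⟩ := hJ σ
    simp only [mem_iInter, mem_inter_iff, mem_preimage, mem_ofPred_eq] at hν
    refine exists_visits_sum_nonneg (fun s => (hν s).2) hD.1 (fun s => (hν s).1) hU hL.le
      (mul_div_cancel₀ ε hL.ne').le (fun j b x hx => ?_) fun j x => ?_
    · rw [hgsome]
      linarith [ha j b x hx]
    · obtain ⟨b, hb⟩ := hU x
      linarith [ha j b x hb, hgnone j b]
  have hqu : u ≤ ∑ j, a j (q j) := by
    simp only [hgsome, Finset.sum_add_distrib, Finset.sum_sub_distrib, Finset.sum_const,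
      Finset.card_univ, Fintype.card_fin, nsmul_eq_mul] at hq
    linarith
  refine ⟨⟨q, hqu⟩, J', hJ'J.trans hJF, hJ', ?_⟩
  calc c₂ * c₁ * (F.card : ℝ) = c₂ * (c₁ * F.card) := mul_assoc _ _ _
    _ ≤ c₂ * J.card := by gcongr
    _ ≤ J'.card := hJ'card

end Transfer

section IndependenceTuples

theorem isClosed_measureIN {Γ Y : Type*} [SMul Γ Y] [TopologicalSpace Y] [MeasurableSpace Y]
    {k : ℕ} (μ : ProbabilityMeasure Y) : IsClosed (measureIN Γ k μ) := by
  refine isClosed_of_closure_subset fun y hy U hU => ?_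
  obtain ⟨z, hzU, hz⟩ := mem_closure_iff.1 hy (univ.pi fun j => interior (U j))
    (isOpen_set_pi finite_univ fun j _ => isOpen_interior)
    fun j _ => mem_interior_iff_mem_nhds.2 (hU j)
  exact hz U fun j => mem_interior_iff_mem_nhds.1 (hzU j (mem_univ j))

theorem exists_mem_measureIN_of_forall_ball {Γ Y : Type*} [SMul Γ Y] [PseudoMetricSpace Y]
    [MeasurableSpace Y] {k : ℕ} {μ : ProbabilityMeasure Y} {K : Set (Fin k → Y)} (hK : IsCompact K)
    (h : ∀ r > 0, ∃ y ∈ K, HasPosSeqIndepDensity Γ μ fun j => Metric.ball (y j) r) :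
    ∃ y ∈ K, y ∈ measureIN Γ k μ := by
  choose y hyK hy using fun n : ℕ => h (1 / (n + 1)) Nat.one_div_pos_of_nat
  obtain ⟨z, hzK, φ, hφ, hz⟩ := hK.tendsto_subseq hyK
  refine ⟨z, hzK, fun U hU => ?_⟩
  have hsub (j : Fin k) : ∀ᶠ n in atTop, Metric.ball (y (φ n) j) (1 / ((φ n : ℕ) + 1)) ⊆ U j := by
    obtain ⟨r, hr, hrU⟩ := Metric.mem_nhds_iff.1 (hU j)
    have hdist : Tendsto (fun n => 1 / ((φ n : ℝ) + 1) + dist (y (φ n) j) (z j)) atTop (𝓝 0) := by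
      simpa using (tendsto_one_div_add_atTop_nhds_zero_nat.comp hφ.tendsto_atTop).add
        (tendsto_iff_dist_tendsto_zero.1 (tendsto_pi_nhds.1 hz j))
    filter_upwards [hdist.eventually_lt_const hr] with n hn
    exact (Metric.ball_subset_ball' hn.le).trans hrU
  obtain ⟨n, hn⟩ := (eventually_all.2 hsub).exists
  exact (hy (φ n)).mono hn

end IndependenceTuples

section Main

variable {Γ X : Type*} [Group Γ] [TopologicalSpace X] [CompactSpace X]
  [TopologicalSpace.MetrizableSpace X] [MeasurableSpace X] [BorelSpace X] [MulAction Γ X]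
  [ContinuousConstSMul Γ X] {k : ℕ} {m : ProbabilityMeasure (ProbabilityMeasure X)}
  {μ : ProbabilityMeasure X} {ν : Fin k → ProbabilityMeasure X}

theorem exists_ball_hasPosSeqIndepDensity {X : Type*} [MetricSpace X] [CompactSpace X]
    [MeasurableSpace X] [BorelSpace X] [MulAction Γ X] [ContinuousConstSMul Γ X]
    {m : ProbabilityMeasure (ProbabilityMeasure X)} {μ : ProbabilityMeasure X}
    (hμ : IsBarycenter m μ) {ν : Fin k → ProbabilityMeasure X} (hν : ν ∈ measureIN Γ k m)
    {f : Fin k → C(X, ℝ)} {u : ℝ} (hu : u < ∑ j, ∫ x, f j x ∂(ν j : Measure X)) {r : ℝ}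
    (hr : 0 < r) :
    ∃ p : Fin k → X, u ≤ ∑ j, f j (p j) ∧
      HasPosSeqIndepDensity Γ μ fun j => Metric.ball (p j) r := by
  set V : ℝ := ∑ j, ∫ x, f j x ∂(ν j : Measure X) with hV
  set ε : ℝ := (V - u) / (2 * k + 1) with hε_def
  have hε : 0 < ε := div_pos (sub_pos.2 hu) (by positivity)
  have hεu : (2 * k + 1) * ε = V - u := by
    rw [hε_def]
    field_simp
  have hfu : UniformContinuous fun x j => f j x :=
    CompactSpace.uniformContinuous_of_continuous (by fun_prop)
  obtain ⟨d, hd, hfd⟩ := Metric.uniformContinuous_iff.1 hfu ε hε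
  obtain ⟨t, -, htfin, ht⟩ :=
    finite_cover_balls_of_compact (isCompact_univ (X := X)) (lt_min hd hr)
  have := htfin.to_subtype
  have hcover (x : X) : ∃ p : t, x ∈ Metric.ball (p : X) (min d r) := by
    simpa using ht (mem_univ x)
  have hf (j : Fin k) (p : t) (x : X) (hx : x ∈ Metric.ball (p : X) (min d r)) :
      f j x ≤ f j p + ε := by
    have hdist := (dist_pi_lt_iff hε).1 (hfd (lt_of_lt_of_le hx (min_le_left _ _))) j
    linarith [(abs_lt.1 hdist).2]
  have hdens : HasPosSeqIndepDensity Γ m fun j => {ν' : ProbabilityMeasure X |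
      ∫ x, f j x ∂(ν j : Measure X) - ε ≤ ∫ x, f j x ∂(ν' : Measure X)} :=
    hν _ fun j => (continuous_integral (f j)).continuousAt.preimage_mem_nhds
      (Ici_mem_nhds (sub_lt_self _ hε))
  obtain ⟨⟨q, hq⟩, hqdens⟩ := (hμ.hasSharedIndepDensity hdens hcover hf (u := u + k * ε)
    (by simp only [Finset.sum_sub_distrib, Finset.sum_const, Finset.card_univ, Fintype.card_fin,
          nsmul_eq_mul, ← hV]
        linarith)).exists_hasPosSeqIndepDensity
  refine ⟨fun j => q j, ?_, hqdens.mono fun j => Metric.ball_subset_ball (min_le_right _ _)⟩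
  simpa only [Finset.sum_add_distrib, Finset.sum_const, Finset.card_univ, Fintype.card_fin,
    nsmul_eq_mul, add_le_add_iff_right] using hq

theorem exists_mem_measureIN_le_sum (hμ : IsBarycenter m μ) (hν : ν ∈ measureIN Γ k m)
    {f : Fin k → C(X, ℝ)} {u : ℝ} (hu : u < ∑ j, ∫ x, f j x ∂(ν j : Measure X)) :
    ∃ y ∈ measureIN Γ k μ, u ≤ ∑ j, f j (y j) := by
  let : MetricSpace X := TopologicalSpace.metrizableSpaceMetric X
  have hK : IsClosed {y : Fin k → X | u ≤ ∑ j, f j (y j)} :=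
    isClosed_le continuous_const (by fun_prop)
  obtain ⟨y, hyu, hy⟩ := exists_mem_measureIN_of_forall_ball hK.isCompact fun r hr =>
    exists_ball_hasPosSeqIndepDensity hμ hν hu hr
  exact ⟨y, hy, hyu⟩

end Main

section Separation

theorem exists_eq_sum_apply {ι E : Type*} [Fintype ι] [AddCommGroup E] [Module ℝ E]
    [TopologicalSpace E] [ContinuousAdd E] [ContinuousConstSMul ℝ E]
    (φ : (ι → WeakDual ℝ E) →L[ℝ] ℝ) :
    ∃ f : ι → E, ∀ w, φ w = ∑ j, w j (f j) := by
  classical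
  choose f hf using fun j => LinearMap.dualEmbedding_surjective (topDualPairing ℝ E)
    (φ.comp (ContinuousLinearMap.single ℝ (fun _ : ι => WeakDual ℝ E) j))
  refine ⟨f, fun w => ?_⟩
  calc φ w = ∑ j, φ (Pi.single j (w j)) := by rw [← map_sum, Finset.univ_sum_single]
    _ = ∑ j, w j (f j) := Finset.sum_congr rfl fun j _ => (DFunLike.congr_fun (hf j) (w j)).symm

theorem mem_closedConvexHull_of_forall_exists_le_sum {ι E : Type*} [Fintype ι] [AddCommGroup E]
    [Module ℝ E] [TopologicalSpace E] [ContinuousAdd E] [ContinuousConstSMul ℝ E]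
    {S : Set (ι → WeakDual ℝ E)} {w : ι → WeakDual ℝ E}
    (h : ∀ (f : ι → E) (u : ℝ), u < ∑ j, w j (f j) → ∃ z ∈ S, u ≤ ∑ j, z j (f j)) :
    w ∈ closedConvexHull ℝ S := by
  have : LocallyConvexSpace ℝ (WeakDual ℝ E) :=
    inferInstanceAs (LocallyConvexSpace ℝ (WeakBilin (topDualPairing ℝ E)))
  by_contra hw
  obtain ⟨φ, u, hφ, hu⟩ := geometric_hahn_banach_closed_point (convex_closedConvexHull (𝕜 := ℝ))
    isClosed_closedConvexHull hw
  obtain ⟨f, hf⟩ := exists_eq_sum_apply φ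
  obtain ⟨z, hz, huz⟩ := h f u (hf w ▸ hu)
  exact (hφ z (subset_closedConvexHull hz)).not_ge (hf z ▸ huz)

/-- The functions `-dist · (x j)` have a strict joint maximum at `x`. -/
theorem mem_closure_of_forall_exists_le_sum {ι X : Type*} [Fintype ι] [TopologicalSpace X]
    [TopologicalSpace.MetrizableSpace X] {S : Set (ι → X)} {x : ι → X}
    (h : ∀ (f : ι → C(X, ℝ)) (u : ℝ), u < ∑ j, f j (x j) → ∃ z ∈ S, u ≤ ∑ j, f j (z j)) :
    x ∈ closure S := by
  let : MetricSpace X := TopologicalSpace.metrizableSpaceMetric X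
  refine Metric.mem_closure_iff.2 fun ε hε => ?_
  obtain ⟨z, hz, hle⟩ := h (fun j => ⟨fun y => -dist (x j) y, by fun_prop⟩) (-(ε / 2))
    (by simpa using hε)
  refine ⟨z, hz, (dist_pi_lt_iff hε).2 fun j => ?_⟩
  have hsum : ∑ j, dist (x j) (z j) ≤ ε / 2 := by simpa using hle
  linarith [Finset.single_le_sum (fun i _ => dist_nonneg (x := x i) (y := z i))
    (Finset.mem_univ j)]

end Separation

section Dirac

variable {X : Type*} [TopologicalSpace X] [MeasurableSpace X] [BorelSpace X] [CompactSpace X]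

@[simp]
theorem tupleToDual_diracTuple_apply {k : ℕ} (x : Fin k → X) (j : Fin k)
    (f : C(X, ℝ)) : tupleToDual (diracTuple x) j f = f (x j) :=
  integral_dirac' _ _ f.continuous.stronglyMeasurable

end Dirac

end MeasureIN

theorem theorem1p6_general {Γ X : Type*} [Group Γ]
    [TopologicalSpace X] [CompactSpace X] [TopologicalSpace.MetrizableSpace X]
    [MeasurableSpace X] [BorelSpace X] [MulAction Γ X] [ContinuousConstSMul Γ X]
    {m : ProbabilityMeasure (ProbabilityMeasure X)} {μ : ProbabilityMeasure X}
    (hμ : MeasureIN.IsBarycenter m μ) (k : ℕ) :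
    MeasureIN.tupleToDual '' MeasureIN.measureIN Γ k m ⊆
        closedConvexHull ℝ
          (MeasureIN.tupleToDual '' (MeasureIN.diracTuple '' MeasureIN.measureIN Γ k μ)) ∧
      ∀ x : Fin k → X, MeasureIN.diracTuple x ∈ MeasureIN.measureIN Γ k m →
        x ∈ MeasureIN.measureIN Γ k μ := by
  constructor
  · rintro _ ⟨ν, hν, rfl⟩
    refine MeasureIN.mem_closedConvexHull_of_forall_exists_le_sum fun f u hu => ?_
    obtain ⟨y, hy, hle⟩ := MeasureIN.exists_mem_measureIN_le_sum hμ hν hu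
    exact ⟨_, mem_image_of_mem _ (mem_image_of_mem _ hy), by simpa using hle⟩
  · intro x hx
    rw [← (MeasureIN.isClosed_measureIN μ).closure_eq]
    refine MeasureIN.mem_closure_of_forall_exists_le_sum fun f u hu =>
      MeasureIN.exists_mem_measureIN_le_sum hμ hx (hu.trans_eq ?_)
    exact Finset.sum_congr rfl fun j _ =>
      (MeasureIN.tupleToDual_diracTuple_apply x j (f j)).symm

theorem theorem1p6 {Γ X : Type*} [Group Γ] [Countable Γ]
    [TopologicalSpace X] [CompactSpace X] [TopologicalSpace.MetrizableSpace X]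
    [MeasurableSpace X] [BorelSpace X] [MulAction Γ X] [ContinuousConstSMul Γ X]
    (m : ProbabilityMeasure (ProbabilityMeasure X))
    (hm : SMulInvariantMeasure Γ (ProbabilityMeasure X) (m : Measure (ProbabilityMeasure X)))
    (μ : ProbabilityMeasure X) (hμ : MeasureIN.IsBarycenter m μ)
    (k : ℕ) (hk : 0 < k) :
    MeasureIN.tupleToDual '' MeasureIN.measureIN Γ k m ⊆
        closedConvexHull ℝ
          (MeasureIN.tupleToDual '' (MeasureIN.diracTuple '' MeasureIN.measureIN Γ k μ)) ∧
      ∀ x : Fin k → X, MeasureIN.diracTuple x ∈ MeasureIN.measureIN Γ k m →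
        x ∈ MeasureIN.measureIN Γ k μ :=
  theorem1p6_general hμ k
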